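/- For $\nu,w\in\mathbb{C}$ let $$D_\nu(w)=2^{\nu/2}e^{-w^2/4}\left(\frac{\sqrt{\pi}}{\Gamma\left(\frac{1-\nu}{2}\right)}\,\Phi\left(-\frac{\nu}{2},\frac12;\frac{w^2}{2}\right)-\frac{\sqrt{2\pi}\,w}{\Gamma\left(-\frac{\nu}{2}\right)}\,\Phi\left(\frac{1-\nu}{2},\frac32;\frac{w^2}{2}\right)\right)$$ be the parabolic cylinder function, where $\Phi(a,b;w)=\sum_{n\ge 0}\frac{(a)_n}{(b)_n}\frac{w^n}{n!}$ is Kummer's confluent hypergeometric function and $1/\Gamma$ is the entire reciprocal Gamma function. Let $z\in\mathbb{C}$ with $\operatorname{Re} z>0$ and let $x\ge 0$ be real. Then $$D_{-z}(x)\bigl(D_{-z}(x)+D_{-z}(-x)\bigr)=\frac{1}{\Gamma(z)}\int_0^\infty\frac{|s-1|^{z-1}}{(s+1)^z}\,e^{-x^2s/2}\,\frac{ds}{\sqrt s},$$ $$D_{-z}(x)\bigl(D_{-z}(x)-D_{-z}(-x)\bigr)=\frac{1}{\Gamma(z)}\int_0^\infty\frac{|s-1|^{z}}{(s+1)^z}\,\frac{1}{s-1}\,e^{-x^2s/2}\,\frac{ds}{\sqrt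 s},$$ and both integrals converge absolutely. -/

import Mathlib

open MeasureTheory Set

/-- Kummer's confluent hypergeometric function
`Φ(a, b; w) = ∑ₙ (a)ₙ / (b)ₙ * wⁿ / n!` (`b` not a non-positive integer), written through
Mathlib's regularized series `∑ₙ (a)ₙ / (Γ(b + n) n!) wⁿ`. -/
noncomputable def kummerPhi (a b w : ℂ) : ℂ :=
  Complex.Gamma b * Complex.regularizedHGFun {a} {b} w

/-- The parabolic cylinder function
`D_ν(w) = 2^(ν/2) e^(-w²/4) (√π / Γ((1-ν)/2) Φ(-ν/2, 1/2; w²/2)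
  - √(2π) w / Γ(-ν/2) Φ((1-ν)/2, 3/2; w²/2))`, an entire function of `ν` and of `w`.
`1 / Γ` is the entire reciprocal Gamma function: Mathlib's `Complex.Gamma` takes the value `0`
at the poles, so the quotients below vanish there. -/
noncomputable def parabolicD (ν w : ℂ) : ℂ :=
  (2 : ℂ) ^ (ν / 2) * Complex.exp (-w ^ 2 / 4) *
    ((Real.sqrt Real.pi : ℂ) / Complex.Gamma ((1 - ν) / 2) *
        kummerPhi (-ν / 2) (1 / 2) (w ^ 2 / 2) -
      (Real.sqrt (2 * Real.pi) : ℂ) * w / Complex.Gamma (-ν / 2) *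
        kummerPhi ((1 - ν) / 2) (3 / 2) (w ^ 2 / 2))

/-- The integrand `|s-1|^(z-1) / (s+1)^z * exp(-x² s / 2) / √s`. -/
noncomputable def plusIntegrand (z : ℂ) (x s : ℝ) : ℂ :=
  ((|s - 1| : ℝ) : ℂ) ^ (z - 1) / ((s + 1 : ℝ) : ℂ) ^ z *
    (Real.exp (-(x ^ 2 / 2) * s) : ℂ) / (Real.sqrt s : ℂ)

/-- The integrand `|s-1|^z / (s+1)^z * 1 / (s-1) * exp(-x² s / 2) / √s`. -/
noncomputable def minusIntegrand (z : ℂ) (x s : ℝ) : ℂ :=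
  ((|s - 1| : ℝ) : ℂ) ^ z / ((s + 1 : ℝ) : ℂ) ^ z * (1 / ((s - 1 : ℝ) : ℂ)) *
    (Real.exp (-(x ^ 2 / 2) * s) : ℂ) / (Real.sqrt s : ℂ)

/-! For `Re z > 0`, `parabolicD_neg_eq_integral` writes `D_{-z}(x)` as `e^{-x²/4} / Γ(z)` times the
integral of `t^{z-1} e^{-t²/2 - xt}`. A product of two values is then an integral over the quadrant
`t, r > 0`. In the coordinates `d = t - r`, `q = tr` the Jacobian is `t + r = √(d² + 4q)`, and this
root is what keeps `d` and `q` coupled.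

The coupling is removed by writing `e^{-x(t+r)} / (t+r)`, or just `1 / (t+r)`, as an integral over
`u` of `exp(-(t+r)² u² - c(u))` (`integral_exp_neg_sq_sub_inv_sq`). Since `(t+r)² = d² + 4q`, for
fixed `u` the integrand splits into a Gaussian in `d` and a Gamma integrand in `q`. Fubini
(`integral_subordinated`) leaves a single integral over `u`.

For `D_{-z}(x)²` the substitution `s = 1 + 1/(2u²)` turns it into the part `s > 1` of the first
integral; for `D_{-z}(x) D_{-z}(-x)`, `s = 2u²/(1+2u²)` gives the part `0 < s < 1`. The two formulas
are the sum and the difference of these parts. -/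

/-! ### Kummer series and the integral representation of `D_{-z}`. -/

theorem HasSum.of_eq {f g : ℕ → ℂ} {a b : ℂ} (h : HasSum f a) (hf : ∀ n, g n = f n)
    (hab : b = a) : HasSum g b := by
  rwa [hab, funext hf]

/-- The power series of Kummer's function. -/
theorem hasSum_kummerPhi (a b w : ℂ) :
    HasSum (fun n : ℕ ↦ Complex.Gamma b * ((ascPochhammer ℂ n).eval a /
      (n.factorial * Complex.Gamma (b + n)) * w ^ n)) (kummerPhi a b w) := by
  have hr : (Complex.regularizedHGFunSeries {a} {b}).radius = ⊤ :=
    Complex.radius_regularizedHGFunSeries_eq_top (by simp)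
  have h := (Complex.regularizedHGFunSeries {a} {b}).hasSum (x := w) (by simp [hr])
  refine (h.mul_left (Complex.Gamma b)).of_eq (fun n ↦ ?_) rfl
  simp [Complex.regularizedHGFunSeries, Complex.regularizedHGFunCoeff,
    FormalMultilinearSeries.ofScalars]

theorem Gamma_add_nat_eq_Gamma_mul_ascPochhammer {a : ℂ} (ha : 0 < a.re) (n : ℕ) :
    Complex.Gamma (a + n) = Complex.Gamma a * (ascPochhammer ℂ n).eval a := by
  rw [← Complex.Gamma_add_nat_div_Gamma_eq]
  · field_simp [Complex.Gamma_ne_zero_of_re_pos ha]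
  · rintro k rfl
    simp at ha
    linarith [(Nat.cast_nonneg k : (0 : ℝ) ≤ k)]

/-- Legendre duplication merges `n! Γ(1/2 + n)` into `(2n)!`, so these are the even terms of the
termwise integrated exponential series; the analogue with `3/2` gives the odd ones. -/
theorem hasSum_Gamma_mul_kummerPhi_half {a : ℂ} (ha : 0 < a.re) (w : ℂ) :
    HasSum (fun n : ℕ ↦ Complex.Gamma (a + n) * (4 * w) ^ n / (2 * n).factorial)
      (Complex.Gamma a * kummerPhi a (1 / 2) w) := by
  refine ((hasSum_kummerPhi a (1 / 2) w).mul_left (Complex.Gamma a)).of_eq (fun n ↦ ?_) rfl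
  have h := Complex.Gamma_mul_Gamma_add_half ((1 / 2 : ℂ) + n)
  have e1 : (1 / 2 : ℂ) + n + 1 / 2 = n + 1 := by ring
  have e2 : 2 * ((1 / 2 : ℂ) + n) = (2 * n : ℕ) + 1 := by push_cast; ring
  have e3 : (1 : ℂ) - ((2 * n : ℕ) + 1) = -((2 * n : ℕ) : ℂ) := by ring
  rw [e1, e2, e3, Complex.Gamma_nat_eq_factorial, Complex.Gamma_nat_eq_factorial,
    Complex.cpow_neg, Complex.cpow_natCast, pow_mul] at h
  norm_num at h
  have hpi : (√Real.pi : ℂ) ≠ 0 := by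
    exact_mod_cast (Real.sqrt_pos.2 Real.pi_pos).ne'
  have hG : Complex.Gamma (1 / 2) = (√Real.pi : ℂ) := by
    rw [Complex.Gamma_one_half_eq, Real.sqrt_eq_rpow, Complex.ofReal_cpow Real.pi_pos.le]
    norm_num
  have hf : ((n.factorial : ℕ) : ℂ) ≠ 0 := by exact_mod_cast n.factorial_ne_zero
  have hf2 : (((2 * n).factorial : ℕ) : ℂ) ≠ 0 := by exact_mod_cast (2 * n).factorial_ne_zero
  rw [Gamma_add_nat_eq_Gamma_mul_ascPochhammer ha, hG]
  have hne : Complex.Gamma (1 / 2 + n) ≠ 0 := by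
    apply Complex.Gamma_ne_zero_of_re_pos
    simp; positivity
  have h2 : Complex.Gamma (1 / 2 + n) * n.factorial * 4 ^ n = (2 * n).factorial * √Real.pi := by
    norm_num
    rw [h]; field_simp
  rw [mul_pow]
  generalize Complex.Gamma (1 / 2 + n) = g at hne h2 ⊢
  field_simp
  linear_combination Complex.Gamma a * (Polynomial.eval a (ascPochhammer ℂ n)) * w ^ n * h2

theorem hasSum_Gamma_mul_kummerPhi_three_halves {a : ℂ} (ha : 0 < a.re) (w : ℂ) :
    HasSum (fun n : ℕ ↦ Complex.Gamma (a + n) * (4 * w) ^ n / (2 * n + 1).factorial)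
      (Complex.Gamma a * kummerPhi a (3 / 2) w) := by
  refine ((hasSum_kummerPhi a (3 / 2) w).mul_left (Complex.Gamma a)).of_eq (fun n ↦ ?_) rfl
  have h := Complex.Gamma_mul_Gamma_add_half ((n : ℂ) + 1)
  have e1 : (n : ℂ) + 1 + 1 / 2 = 3 / 2 + n := by ring
  have e2 : 2 * ((n : ℂ) + 1) = (2 * n + 1 : ℕ) + 1 := by push_cast; ring
  have e3 : (1 : ℂ) - ((2 * n + 1 : ℕ) + 1) = -((2 * n + 1 : ℕ) : ℂ) := by ring
  rw [e1, e2, e3, Complex.Gamma_nat_eq_factorial, Complex.Gamma_nat_eq_factorial,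
    Complex.cpow_neg, Complex.cpow_natCast, pow_succ, pow_mul] at h
  have hpi : (√Real.pi : ℂ) ≠ 0 := by
    exact_mod_cast (Real.sqrt_pos.2 Real.pi_pos).ne'
  have hG : Complex.Gamma (3 / 2) = (√Real.pi : ℂ) / 2 := by
    rw [show (3 / 2 : ℂ) = 1 / 2 + 1 by norm_num, Complex.Gamma_add_one _ (by norm_num),
      Complex.Gamma_one_half_eq, Real.sqrt_eq_rpow, Complex.ofReal_cpow Real.pi_pos.le]
    norm_num
    ring
  have hf : ((n.factorial : ℕ) : ℂ) ≠ 0 := by exact_mod_cast n.factorial_ne_zero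
  have hf2 : (((2 * n + 1).factorial : ℕ) : ℂ) ≠ 0 := by
    exact_mod_cast (2 * n + 1).factorial_ne_zero
  rw [Gamma_add_nat_eq_Gamma_mul_ascPochhammer ha, hG]
  have hne : Complex.Gamma (3 / 2 + n) ≠ 0 := by
    apply Complex.Gamma_ne_zero_of_re_pos
    simp; positivity
  have h2 : 2 * (Complex.Gamma (3 / 2 + n) * n.factorial * 4 ^ n) =
      (2 * n + 1).factorial * √Real.pi := by
    rw [mul_comm (Complex.Gamma _), h]; norm_num; field_simp
  rw [mul_pow]
  generalize Complex.Gamma (3 / 2 + n) = g at hne h2 ⊢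
  field_simp
  linear_combination Complex.Gamma a * (Polynomial.eval a (ascPochhammer ℂ n)) * w ^ n * h2

/-- The Mellin transform of a Gaussian. -/
theorem integral_cpow_mul_exp_neg_sq_div_two {s : ℂ} (hs : 0 < s.re) :
    ∫ t in Ioi (0 : ℝ), (t : ℂ) ^ (s - 1) * (Real.exp (-(t ^ 2 / 2)) : ℂ) =
      2 ^ (s / 2 - 1) * Complex.Gamma (s / 2) := by
  have h1 := mellin_comp_rpow (fun t : ℝ ↦ (Real.exp (-(t / 2)) : ℂ)) s 2
  have h2 := Complex.integral_cpow_mul_exp_neg_mul_Ioi (a := s / 2) (r := 1 / 2)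
    (by simpa using hs) (by norm_num)
  simp only [mellin, smul_eq_mul] at h1
  have e : ∀ t : ℝ, (Real.exp (-(t / 2)) : ℂ) = Complex.exp (-(((1 / 2 : ℝ) : ℂ) * t)) := by
    intro t; push_cast; congr 1; ring
  simp only [Real.rpow_two] at h1
  rw [h1]
  simp only [e]
  push_cast at h2 ⊢
  rw [h2, Complex.cpow_sub _ _ two_ne_zero]
  norm_num
  ring

theorem integrableOn_rpow_mul_exp_neg_sq_add {σ : ℝ} (hσ : 0 < σ) (b : ℝ) :
    IntegrableOn (fun t : ℝ ↦ t ^ (σ - 1) * Real.exp (-(t ^ 2 / 2) + b * t)) (Ioi 0) := by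
  have h := (integrableOn_rpow_mul_exp_neg_mul_sq (b := 1 / 4) (by norm_num)
    (s := σ - 1) (by linarith)).const_mul (Real.exp (b ^ 2))
  refine h.mono' (by fun_prop) ?_
  filter_upwards [ae_restrict_mem measurableSet_Ioi] with t ht
  have ht0 : 0 < t := ht
  rw [Real.norm_of_nonneg (by positivity), mul_left_comm, ← Real.exp_add]
  refine mul_le_mul_of_nonneg_left (Real.exp_le_exp.2 ?_) (by positivity)
  -- `-t²/2 + bt ≤ -t²/4 + b²`, which explains the constants `1/4` and `exp (b²)`.
  nlinarith [sq_nonneg (t / 2 - b)]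

/-- Expand `e^{-xt}` and integrate termwise; the absolute values of the terms sum to the same
integrand with `e^{|x|t}`, which is integrable. -/
theorem hasSum_integral_cpow_mul_exp {z : ℂ} (hz : 0 < z.re) (x : ℝ) :
    HasSum (fun n : ℕ ↦ (-x : ℂ) ^ n / n.factorial *
        (2 ^ ((z + n) / 2 - 1) * Complex.Gamma ((z + n) / 2)))
      (∫ t in Ioi (0 : ℝ), (t : ℂ) ^ (z - 1) * (Real.exp (-(t ^ 2 / 2) - x * t) : ℂ)) := by
  have key := hasSum_integral_of_dominated_convergence (μ := volume.restrict (Ioi (0 : ℝ)))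
    (F := fun (n : ℕ) (t : ℝ) ↦ (-x : ℂ) ^ n / n.factorial *
      ((t : ℂ) ^ (z + n - 1) * (Real.exp (-(t ^ 2 / 2)) : ℂ)))
    (f := fun t ↦ (t : ℂ) ^ (z - 1) * (Real.exp (-(t ^ 2 / 2) - x * t) : ℂ))
    (fun n t ↦ (|x| * t) ^ n / n.factorial * (t ^ (z.re - 1) * Real.exp (-(t ^ 2 / 2))))
    ?_ ?_ ?_ ?_ ?_
  · refine key.of_eq (fun n ↦ ?_) rfl
    rw [integral_const_mul, integral_cpow_mul_exp_neg_sq_div_two]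
    simp; positivity
  · intro n
    refine Measurable.aestronglyMeasurable ?_
    fun_prop
  · intro n
    filter_upwards [ae_restrict_mem measurableSet_Ioi] with t ht
    have ht0 : 0 < t := ht
    rw [norm_mul, norm_mul, Complex.norm_cpow_eq_rpow_re_of_pos ht0, Complex.norm_real,
      Real.norm_of_nonneg (Real.exp_nonneg _), norm_div, norm_pow, norm_neg, Complex.norm_real,
      Complex.norm_natCast, Real.norm_eq_abs]
    simp only [Complex.sub_re, Complex.add_re, Complex.natCast_re, Complex.one_re]
    rw [show z.re + n - 1 = (z.re - 1) + n by ring, Real.rpow_add_natCast ht0.ne', mul_pow]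
    apply le_of_eq; ring
  · filter_upwards with t
    exact (Real.summable_pow_div_factorial _).mul_right _
  · refine (integrableOn_rpow_mul_exp_neg_sq_add hz |x|).congr ?_
    filter_upwards with t
    rw [tsum_mul_right, ← congrFun NormedSpace.exp_eq_tsum_div (|x| * t), ← Real.exp_eq_exp_ℝ,
       Real.exp_add]
    ring
  · filter_upwards [ae_restrict_mem measurableSet_Ioi] with t ht
    have ht0 : 0 < t := ht
    have h := (NormedSpace.expSeries_div_hasSum_exp (𝔸 := ℂ) (-x * t)).mul_right
      ((t : ℂ) ^ (z - 1) * (Real.exp (-(t ^ 2 / 2)) : ℂ))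
    refine h.of_eq (fun n ↦ ?_) ?_
    · rw [show z + n - 1 = (z - 1) + n by ring,
        Complex.cpow_add _ _ (by exact_mod_cast ht0.ne'), Complex.cpow_natCast, mul_pow]
      ring
    · rw [← Complex.exp_eq_exp_ℂ]
      push_cast
      rw [mul_left_comm, ← Complex.exp_add]
      ring_nf

/-- The integral representation of `D_{-z}` on the real line for `Re z > 0`. -/
theorem parabolicD_neg_eq_integral {z : ℂ} (hz : 0 < z.re) (x : ℝ) :
    parabolicD (-z) x = Real.exp (-(x ^ 2 / 4)) / Complex.Gamma z *
      ∫ t in Ioi (0 : ℝ), (t : ℂ) ^ (z - 1) * (Real.exp (-(t ^ 2 / 2) - x * t) : ℂ) := by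
  have h2ne : (2 : ℂ) ≠ 0 := two_ne_zero
  have hz2 : 0 < (z / 2).re := by simpa using hz
  have hz3 : 0 < ((1 + z) / 2).re := by simp; linarith
  have he := (hasSum_Gamma_mul_kummerPhi_half hz2 ((x : ℂ) ^ 2 / 2)).mul_left
    ((2 : ℂ) ^ (z / 2 - 1))
  have ho := (hasSum_Gamma_mul_kummerPhi_three_halves hz3 ((x : ℂ) ^ 2 / 2)).mul_left
    (-x * (2 : ℂ) ^ ((1 + z) / 2 - 1))
  have hsum := HasSum.even_add_odd
    (f := fun n : ℕ ↦ (-x : ℂ) ^ n / n.factorial *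
        (2 ^ ((z + n) / 2 - 1) * Complex.Gamma ((z + n) / 2)))
    (by
      refine he.of_eq (fun n ↦ ?_) rfl
      rw [show (z + (2 * n : ℕ)) / 2 = z / 2 + n by push_cast; ring,
        show z / 2 + n - 1 = (z / 2 - 1) + n by ring, Complex.cpow_add _ _ h2ne,
        Complex.cpow_natCast, pow_mul, show 4 * ((x : ℂ) ^ 2 / 2) = 2 * x ^ 2 by ring, mul_pow,
        neg_sq]
      ring)
    (by
      refine ho.of_eq (fun n ↦ ?_) rfl
      rw [show (z + (2 * n + 1 : ℕ)) / 2 = (1 + z) / 2 + n by push_cast; ring,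
        show (1 + z) / 2 + n - 1 = ((1 + z) / 2 - 1) + n by ring, Complex.cpow_add _ _ h2ne,
        Complex.cpow_natCast, pow_succ, pow_mul,
        show 4 * ((x : ℂ) ^ 2 / 2) = 2 * x ^ 2 by ring, mul_pow, neg_sq]
      ring)
  rw [(hasSum_integral_cpow_mul_exp hz x).unique hsum, parabolicD]
  have hd := Complex.Gamma_mul_Gamma_add_half (z / 2)
  rw [show z / 2 + 1 / 2 = (1 + z) / 2 by ring, show 2 * (z / 2) = z by ring] at hd
  have g1 := Complex.Gamma_ne_zero_of_re_pos hz
  have g2 := Complex.Gamma_ne_zero_of_re_pos hz2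
  have g3 := Complex.Gamma_ne_zero_of_re_pos hz3
  rw [show -(-z) / 2 = z / 2 by ring, show (1 - -z) / 2 = (1 + z) / 2 by ring,
    show -(x : ℂ) ^ 2 / 4 = ((-(x ^ 2 / 4) : ℝ) : ℂ) by push_cast; ring, ← Complex.ofReal_exp]
  have hp : ((2 : ℂ) ^ (z / 2)) ≠ 0 := by simp [Complex.cpow_eq_zero_iff]
  have hs2 : (√2 : ℂ) ^ 2 = 2 := by
    norm_cast; rw [Real.sq_sqrt (by norm_num)]
  have hs2' : (√2 : ℂ) ≠ 0 := by intro h; rw [h] at hs2; norm_num at hs2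
  have c1 : (2 : ℂ) ^ (1 - z) = 2 / ((2 : ℂ) ^ (z / 2)) ^ 2 := by
    rw [Complex.cpow_sub _ _ h2ne, Complex.cpow_one, ← Complex.cpow_nat_mul]
    congr 2; push_cast; ring
  have c2 : (2 : ℂ) ^ ((1 + z) / 2 - 1) = √2 * (2 : ℂ) ^ (z / 2) / 2 := by
    rw [Complex.cpow_sub _ _ h2ne, Complex.cpow_one, show (1 + z) / 2 = 1 / 2 + z / 2 by ring,
      Complex.cpow_add _ _ h2ne, Real.sqrt_eq_rpow, Complex.ofReal_cpow (by norm_num)]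
    norm_num
  have c3 : (2 : ℂ) ^ (-z / 2) = ((2 : ℂ) ^ (z / 2))⁻¹ := by
    rw [← Complex.cpow_neg]; congr 1; ring
  rw [c1] at hd
  rw [c2, c3, Complex.cpow_sub _ _ h2ne, Complex.cpow_one, Real.sqrt_mul (by norm_num)]
  push_cast
  generalize (2 : ℂ) ^ (z / 2) = p at *
  generalize kummerPhi (z / 2) (1 / 2) _ = k1
  generalize kummerPhi ((1 + z) / 2) (3 / 2) _ = k2
  have hd' : Complex.Gamma (z / 2) * Complex.Gamma ((1 + z) / 2) * p ^ 2 =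
      2 * Complex.Gamma z * √Real.pi := by rw [hd]; field_simp
  generalize Complex.Gamma z = A at *
  generalize Complex.Gamma (z / 2) = B at *
  generalize Complex.Gamma ((1 + z) / 2) = C at *
  -- Duplication at `z/2` eliminates `√π`, after which both sides are rational in the remaining
  -- quantities.
  have hr : (√Real.pi : ℂ) = B * C * p ^ 2 / (2 * A) := by rw [hd']; field_simp
  rw [hr]
  field_simp
  ring

/-! ### The integral of `exp(-P²u² - b²/u²)`. -/

/-- The second summand is odd and drops out. With `c = 4Pb`, the factor `1 + d/√(d² + c)` is `2P
du/dd` for the inverse of `d = Pu - b/u`. -/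
theorem integral_exp_neg_sq_mul_one_add_odd {c : ℝ} (hc : 0 < c) :
    ∫ d : ℝ, Real.exp (-d ^ 2) * (1 + d / √(d ^ 2 + c)) = √Real.pi := by
  have hi : Integrable (fun d : ℝ ↦ Real.exp (-d ^ 2)) := by
    simpa using integrable_exp_neg_mul_sq (b := 1) one_pos
  have hi2 : Integrable (fun d : ℝ ↦ Real.exp (-d ^ 2) * (d / √(d ^ 2 + c))) := by
    refine hi.mono' (by fun_prop) (Filter.Eventually.of_forall fun d ↦ ?_)
    rw [norm_mul, Real.norm_of_nonneg (Real.exp_nonneg _)]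
    refine mul_le_of_le_one_right (Real.exp_nonneg _) ?_
    rw [norm_div, Real.norm_of_nonneg (Real.sqrt_nonneg _), Real.norm_eq_abs]
    exact div_le_one_of_le₀ (Real.abs_le_sqrt (by linarith)) (Real.sqrt_nonneg _)
  have hodd : ∫ d : ℝ, Real.exp (-d ^ 2) * (d / √(d ^ 2 + c)) = 0 := by
    have h := integral_neg_eq_self (fun d : ℝ ↦ Real.exp (-d ^ 2) * (d / √(d ^ 2 + c))) volume
    simp only [neg_sq, neg_div, mul_neg, integral_neg] at h
    linarith
  simp only [mul_add, mul_one]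
  rw [integral_add hi hi2, hodd, add_zero]
  simpa using integral_gaussian 1

theorem image_mul_sub_div_Ioi {P b : ℝ} (hP : 0 < P) (hb : 0 < b) :
    (fun u : ℝ ↦ P * u - b / u) '' Ioi 0 = univ := by
  refine eq_univ_of_forall fun d ↦ ?_
  have hs : 0 < d + √(d ^ 2 + 4 * (P * b)) := by
    have : |d| < √(d ^ 2 + 4 * (P * b)) := by
      rw [← Real.sqrt_sq_eq_abs]
      exact Real.sqrt_lt_sqrt (sq_nonneg _) (by nlinarith [mul_pos hP hb])
    linarith [neg_abs_le d]
  have hq : √(d ^ 2 + 4 * (P * b)) ^ 2 = d ^ 2 + 4 * (P * b) := Real.sq_sqrt (by positivity)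
  -- The positive root of `P u² - d u - b = 0`.
  refine ⟨(d + √(d ^ 2 + 4 * (P * b))) / (2 * P), by simp only [mem_Ioi]; positivity, ?_⟩
  simp only
  generalize √(d ^ 2 + 4 * (P * b)) = r at hs hq ⊢
  have hs' := hs.ne'
  field_simp
  linear_combination hq

theorem injOn_mul_sub_div_Ioi {P b : ℝ} (hP : 0 < P) (hb : 0 < b) :
    InjOn (fun u : ℝ ↦ P * u - b / u) (Ioi 0) := by
  intro u hu v hv h
  have hu : 0 < u := hu
  have hv : 0 < v := hv
  simp only at h
  field_simp at h
  have : (u - v) * (P * u * v + b) = 0 := by linear_combination h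
  rcases mul_eq_zero.1 this with h | h
  · linarith
  · have : 0 < P * u * v + b := by positivity
    linarith

/-- The Laplace-type integral `∫ exp (-P² u² - b² / u²) du`. -/
theorem integral_exp_neg_sq_sub_inv_sq {P b : ℝ} (hP : 0 < P) (hb : 0 ≤ b) :
    ∫ u in Ioi (0 : ℝ), Real.exp (-(P ^ 2 * u ^ 2) - b ^ 2 / u ^ 2) =
      √Real.pi / (2 * P) * Real.exp (-(2 * P * b)) := by
  rcases hb.eq_or_lt with rfl | hb
  · have h := integral_gaussian_Ioi (P ^ 2)
    rw [Real.sqrt_div Real.pi_pos.le, Real.sqrt_sq hP.le] at h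
    simp only [neg_mul] at h
    simp [h]
    field_simp
  -- With `d = Pu - b/u` the exponent is `-d² - 2Pb`, and `d` runs over the whole line; for `b = 0`
  -- it would cover only a half-line, hence the separate case.
  · have h := integral_image_eq_integral_abs_deriv_smul (s := Ioi (0 : ℝ)) measurableSet_Ioi
      (f := fun u : ℝ ↦ P * u - b / u) (f' := fun u ↦ P + b / u ^ 2)
      (fun u hu ↦ by
        have hu : 0 < u := hu
        have := ((hasDerivAt_id u).const_mul P).sub ((hasDerivAt_inv hu.ne').const_mul b)
        refine HasDerivAt.hasDerivWithinAt ?_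
        convert! this using 1
        field_simp
        ring)
      (injOn_mul_sub_div_Ioi hP hb)
      (fun d ↦ Real.exp (-d ^ 2) * (1 + d / √(d ^ 2 + 4 * (P * b))))
    rw [image_mul_sub_div_Ioi hP hb, setIntegral_univ,
      integral_exp_neg_sq_mul_one_add_odd (by positivity)] at h
    rw [show √Real.pi / (2 * P) * Real.exp (-(2 * P * b)) =
      Real.exp (-(2 * P * b)) / (2 * P) * √Real.pi by ring, h, ← integral_const_mul]
    refine setIntegral_congr_fun measurableSet_Ioi fun u hu ↦ ?_
    have hu : 0 < u := hu
    have hr : √((P * u - b / u) ^ 2 + 4 * (P * b)) = P * u + b / u := by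
      rw [show (P * u - b / u) ^ 2 + 4 * (P * b) = (P * u + b / u) ^ 2 by field_simp; ring]
      exact Real.sqrt_sq (by positivity)
    have he : Real.exp (-(P ^ 2 * u ^ 2) - b ^ 2 / u ^ 2) =
        Real.exp (-(2 * P * b)) * Real.exp (-(P * u - b / u) ^ 2) := by
      rw [← Real.exp_add]
      congr 1
      field_simp
      ring
    have hpos : P * u ^ 2 + b ≠ 0 := by positivity
    simp only [smul_eq_mul]
    rw [hr, he, abs_of_pos (by positivity)]
    field_simp
    ring

/-! ### The change of variables `(t, r) ↦ (t - r, tr)`. -/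

theorem image_sub_mul_Ioi_prod_Ioi :
    (fun p : ℝ × ℝ ↦ (p.1 - p.2, p.1 * p.2)) '' (Ioi 0 ×ˢ Ioi 0) = univ ×ˢ Ioi 0 := by
  ext ⟨d, q⟩
  simp only [mem_image, mem_prod, mem_Ioi, mem_univ, true_and, Prod.exists, Prod.mk.injEq]
  constructor
  · rintro ⟨t, r, ⟨ht, hr⟩, rfl, rfl⟩
    positivity
  · intro hq
    have hlt : |d| < √(d ^ 2 + 4 * q) := by
      rw [← Real.sqrt_sq_eq_abs]
      exact Real.sqrt_lt_sqrt (sq_nonneg _) (by linarith)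
    have hs : √(d ^ 2 + 4 * q) ^ 2 = d ^ 2 + 4 * q := Real.sq_sqrt (by positivity)
    -- Recovered from `t + r = √(d² + 4q)` and `t - r = d`.
    refine ⟨(√(d ^ 2 + 4 * q) + d) / 2, (√(d ^ 2 + 4 * q) - d) / 2, ⟨?_, ?_⟩, by ring, ?_⟩
    · linarith [neg_abs_le d]
    · linarith [le_abs_self d]
    · linear_combination hs / 4

theorem injOn_sub_mul_Ioi_prod_Ioi :
    InjOn (fun p : ℝ × ℝ ↦ (p.1 - p.2, p.1 * p.2)) (Ioi 0 ×ˢ Ioi 0) := by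
  rintro ⟨t, r⟩ ⟨ht, hr⟩ ⟨t', r'⟩ ⟨ht', hr'⟩ h
  simp only [mem_Ioi, Prod.mk.injEq] at *
  obtain ⟨h1, h2⟩ := h
  have h3 : (t - t') * (t + r') = 0 := by
    have : r = t - t' + r' := by linarith
    subst this
    linear_combination h2
  rcases mul_eq_zero.1 h3 with h | h
  · constructor <;> linarith
  · linarith

/-- The derivative of `(t, r) ↦ (t - r, t * r)`. -/
noncomputable def fderivSubMul (p : ℝ × ℝ) : ℝ × ℝ →L[ℝ] ℝ × ℝ :=
  (Matrix.toLin (Module.Basis.finTwoProd ℝ) (Module.Basis.finTwoProd ℝ)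
    !![1, -1; p.2, p.1]).toContinuousLinearMap

theorem hasFDerivAt_sub_mul (p : ℝ × ℝ) :
    HasFDerivAt (fun p : ℝ × ℝ ↦ (p.1 - p.2, p.1 * p.2)) (fderivSubMul p) p := by
  unfold fderivSubMul
  rw [Matrix.toLin_finTwoProd_toContinuousLinearMap]
  have h1 : HasFDerivAt (fun p : ℝ × ℝ ↦ p.1 - p.2) _ p :=
    (hasFDerivAt_fst (𝕜 := ℝ)).sub hasFDerivAt_snd
  have h2 : HasFDerivAt (fun p : ℝ × ℝ ↦ p.1 * p.2) _ p :=
    (hasFDerivAt_fst (𝕜 := ℝ)).mul hasFDerivAt_snd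
  convert! h1.prodMk h2 using 2 <;> ext <;> simp

theorem det_fderivSubMul (p : ℝ × ℝ) : (fderivSubMul p).det = p.1 + p.2 := by
  unfold fderivSubMul
  simp [LinearMap.det_toContinuousLinearMap, LinearMap.det_toLin, Matrix.det_fin_two_of]

/-- The change of variables `(t, r) ↦ (t - r, t * r)` on the open quadrant. -/
theorem setIntegral_quadrant_sub_mul (f : ℝ × ℝ → ℂ) :
    ∫ p in Ioi (0 : ℝ) ×ˢ Ioi (0 : ℝ), ((p.1 + p.2 : ℝ) : ℂ) * f (p.1 - p.2, p.1 * p.2) =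
      ∫ p in (univ : Set ℝ) ×ˢ Ioi (0 : ℝ), f p := by
  have hm : MeasurableSet (Ioi (0 : ℝ) ×ˢ Ioi (0 : ℝ)) := measurableSet_Ioi.prod measurableSet_Ioi
  rw [← image_sub_mul_Ioi_prod_Ioi, integral_image_eq_integral_abs_det_fderiv_smul volume hm
    (fun p _ ↦ (hasFDerivAt_sub_mul p).hasFDerivWithinAt) injOn_sub_mul_Ioi_prod_Ioi]
  refine setIntegral_congr_fun hm fun p hp ↦ ?_
  have h1 : 0 < p.1 := hp.1
  have h2 : 0 < p.2 := hp.2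
  simp only [det_fderivSubMul, abs_of_pos (add_pos h1 h2), Complex.real_smul]

/-! ### The Gaussian integral in `d` and the Gamma integral in `q`. -/

theorem exp_quadratic_eq_shift {b : ℝ} (hb : 0 < b) (y d : ℝ) :
    Real.exp (-(b * d ^ 2) - y * d) =
      Real.exp (y ^ 2 / (4 * b)) * Real.exp (-b * (d + y / (2 * b)) ^ 2) := by
  rw [← Real.exp_add]
  congr 1
  field_simp
  ring

theorem integral_exp_neg_quadratic {b : ℝ} (hb : 0 < b) (y : ℝ) :
    ∫ d : ℝ, Real.exp (-(b * d ^ 2) - y * d) =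
      √Real.pi * (√b)⁻¹ * Real.exp (y ^ 2 / (4 * b)) := by
  simp only [exp_quadratic_eq_shift hb]
  rw [integral_const_mul,
    integral_add_right_eq_self (fun d : ℝ ↦ Real.exp (-b * d ^ 2)) (y / (2 * b)),
    integral_gaussian, Real.sqrt_div Real.pi_pos.le]
  ring

theorem integrable_exp_neg_quadratic {b : ℝ} (hb : 0 < b) (y : ℝ) :
    Integrable (fun d : ℝ ↦ Real.exp (-(b * d ^ 2) - y * d)) := by
  simp only [exp_quadratic_eq_shift hb]
  exact ((integrable_exp_neg_mul_sq hb).comp_add_right (y / (2 * b))).const_mul _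

theorem integrableOn_cpow_mul_exp_neg_mul {z : ℂ} (hz : 0 < z.re) {m : ℝ} (hm : 0 < m) :
    IntegrableOn (fun q : ℝ ↦ (q : ℂ) ^ (z - 1) * (Real.exp (-(m * q)) : ℂ)) (Ioi 0) := by
  have h := integrableOn_rpow_mul_exp_neg_mul_rpow (p := 1) (s := z.re - 1) (b := m)
    (by linarith) one_pos hm
  refine Integrable.mono' h (Measurable.aestronglyMeasurable (by fun_prop)) ?_
  filter_upwards [ae_restrict_mem measurableSet_Ioi] with q hq
  rw [norm_mul, Complex.norm_cpow_eq_rpow_re_of_pos hq, Complex.norm_real,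
    Real.norm_of_nonneg (Real.exp_nonneg _)]
  simp

theorem integral_norm_cpow_mul_exp_neg_mul {z : ℂ} (hz : 0 < z.re) {m : ℝ} (hm : 0 < m) :
    ∫ q in Ioi (0 : ℝ), ‖(q : ℂ) ^ (z - 1) * (Real.exp (-(m * q)) : ℂ)‖ =
      m ^ (-z.re) * Real.Gamma z.re := by
  rw [Real.rpow_neg hm.le, ← Real.inv_rpow hm.le, ← one_div,
    ← Real.integral_rpow_mul_exp_neg_mul_Ioi hz hm]
  refine setIntegral_congr_fun measurableSet_Ioi fun q hq ↦ ?_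
  rw [norm_mul, Complex.norm_cpow_eq_rpow_re_of_pos hq, Complex.norm_real,
    Real.norm_of_nonneg (Real.exp_nonneg _)]
  simp

theorem integral_cpow_mul_exp_neg_mul {z : ℂ} (hz : 0 < z.re) {m : ℝ} (hm : 0 < m) :
    ∫ q in Ioi (0 : ℝ), (q : ℂ) ^ (z - 1) * (Real.exp (-(m * q)) : ℂ) =
      (m : ℂ) ^ (-z) * Complex.Gamma z := by
  have h := Complex.integral_cpow_mul_exp_neg_mul_Ioi hz hm
  rw [one_div, ← Complex.ofReal_inv, Complex.ofReal_inv,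
    Complex.inv_cpow _ _ (by rw [Complex.arg_ofReal_of_nonneg hm.le]; exact Real.pi_pos.ne),
    ← Complex.cpow_neg] at h
  rw [← h]
  push_cast
  rfl

/-! ### Decoupling by the auxiliary variable `u` and Fubini. -/

/-- The integrand in the auxiliary variable `u`. -/
noncomputable def subordinated (z : ℂ) (c : ℝ → ℝ) (y u : ℝ) : ℂ :=
  ((1 + 4 * u ^ 2 : ℝ) : ℂ) ^ (-z) *
    (((√(1 / 2 + u ^ 2))⁻¹ * Real.exp (-c u + y ^ 2 / (2 + 4 * u ^ 2)) : ℝ) : ℂ)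

theorem norm_subordinated (z : ℂ) (c : ℝ → ℝ) (y u : ℝ) :
    ‖subordinated z c y u‖ = (1 + 4 * u ^ 2) ^ (-z.re) *
      ((√(1 / 2 + u ^ 2))⁻¹ * Real.exp (-c u + y ^ 2 / (2 + 4 * u ^ 2))) := by
  rw [subordinated, norm_mul, Complex.norm_cpow_eq_rpow_re_of_pos (by positivity),
    Complex.norm_real, Real.norm_of_nonneg (by positivity)]
  simp

@[fun_prop]
theorem measurable_subordinated (z : ℂ) {c : ℝ → ℝ} (hc : Measurable c) (y : ℝ) :
    Measurable (subordinated z c y) := by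
  unfold subordinated
  fun_prop

/-- The exponential is at most `e^{y²/2}` because `c ≥ 0`, and the other factors decay like `(1 +
u²)^{-Re z - 1/2}`, integrable since `Re z > 0`. -/
theorem integrable_subordinated {z : ℂ} (hz : 0 < z.re) {c : ℝ → ℝ} (hc : Measurable c)
    (hc0 : ∀ u, 0 ≤ c u) (y : ℝ) : Integrable (subordinated z c y) := by
  have h := (integrable_rpow_neg_one_add_norm_sq (E := ℝ) (μ := volume) (r := 2 * z.re + 1)
    (by simp; linarith)).const_mul (√2 * Real.exp (y ^ 2 / 2))
  refine h.mono' (measurable_subordinated z hc y).aestronglyMeasurable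
    (Filter.Eventually.of_forall fun u ↦ ?_)
  have hu : 0 ≤ u ^ 2 := sq_nonneg u
  have h1 : (1 + 4 * u ^ 2) ^ (-z.re) ≤ (1 + u ^ 2) ^ (-z.re) :=
    Real.rpow_le_rpow_of_nonpos (by positivity) (by linarith) (by linarith)
  have h2 : (√(1 / 2 + u ^ 2))⁻¹ ≤ √2 * (1 + u ^ 2) ^ (-(1 / 2) : ℝ) := by
    rw [Real.rpow_neg (by positivity), ← Real.sqrt_eq_rpow, ← div_eq_mul_inv,
      ← Real.sqrt_div (by norm_num), ← Real.sqrt_inv]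
    apply Real.sqrt_le_sqrt
    rw [inv_le_comm₀ (by positivity) (by positivity), inv_div]
    linarith
  have h3 : Real.exp (-c u + y ^ 2 / (2 + 4 * u ^ 2)) ≤ Real.exp (y ^ 2 / 2) := by
    apply Real.exp_le_exp.2
    have : y ^ 2 / (2 + 4 * u ^ 2) ≤ y ^ 2 / 2 := by gcongr; linarith
    linarith [hc0 u]
  rw [norm_subordinated]
  calc _ ≤ (1 + u ^ 2) ^ (-z.re) *
        ((√2 * (1 + u ^ 2) ^ (-(1 / 2) : ℝ)) * Real.exp (y ^ 2 / 2)) := by gcongr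
    _ = _ := by
      rw [Real.norm_eq_abs, sq_abs, show -(2 * z.re + 1) / 2 = -z.re + -(1 / 2) by ring,
        Real.rpow_add (by positivity)]
      ring

/-- The integrand of the triple integral. -/
noncomputable def tripleIntegrand (z : ℂ) (c : ℝ → ℝ) (y u : ℝ) (p : ℝ × ℝ) : ℂ :=
  (Real.exp (-c u) : ℂ) *
    ((Real.exp (-((1 / 2 + u ^ 2) * p.1 ^ 2) - y * p.1) : ℂ) *
      ((p.2 : ℂ) ^ (z - 1) * (Real.exp (-((1 + 4 * u ^ 2) * p.2)) : ℂ)))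

theorem measurable_tripleIntegrand (z : ℂ) {c : ℝ → ℝ} (hc : Measurable c) (y : ℝ) :
    Measurable (Function.uncurry (tripleIntegrand z c y)) := by
  unfold tripleIntegrand Function.uncurry
  fun_prop

theorem integral_tripleIntegrand {z : ℂ} (hz : 0 < z.re) (c : ℝ → ℝ) (y u : ℝ) :
    ∫ p, tripleIntegrand z c y u p ∂(volume.prod (volume.restrict (Ioi 0))) =
      Complex.Gamma z * √Real.pi * subordinated z c y u := by
  unfold tripleIntegrand
  rw [integral_const_mul, integral_prod_mul
      (fun d : ℝ ↦ (Real.exp (-((1 / 2 + u ^ 2) * d ^ 2) - y * d) : ℂ))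
      (fun q : ℝ ↦ (q : ℂ) ^ (z - 1) * (Real.exp (-((1 + 4 * u ^ 2) * q)) : ℂ)),
    integral_complex_ofReal, integral_exp_neg_quadratic (by positivity),
    integral_cpow_mul_exp_neg_mul hz (by positivity), subordinated, Real.exp_add,
    show 4 * (1 / 2 + u ^ 2) = 2 + 4 * u ^ 2 by ring]
  push_cast
  ring

theorem integral_norm_tripleIntegrand {z : ℂ} (hz : 0 < z.re) (c : ℝ → ℝ) (y u : ℝ) :
    ∫ p, ‖tripleIntegrand z c y u p‖ ∂(volume.prod (volume.restrict (Ioi 0))) =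
      Real.Gamma z.re * √Real.pi * ‖subordinated z c y u‖ := by
  unfold tripleIntegrand
  simp only [norm_mul (Real.exp (-c u) : ℂ),
    norm_mul (Real.exp (-((1 / 2 + u ^ 2) * _ ^ 2) - y * _) : ℂ)]
  rw [integral_const_mul, integral_prod_mul
      (fun d : ℝ ↦ ‖(Real.exp (-((1 / 2 + u ^ 2) * d ^ 2) - y * d) : ℂ)‖)
      (fun q : ℝ ↦ ‖(q : ℂ) ^ (z - 1) * (Real.exp (-((1 + 4 * u ^ 2) * q)) : ℂ)‖),
    integral_norm_cpow_mul_exp_neg_mul hz (by positivity), norm_subordinated]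
  simp only [Complex.norm_real, Real.norm_of_nonneg (Real.exp_nonneg _)]
  rw [integral_exp_neg_quadratic (by positivity), Real.exp_add,
    show 4 * (1 / 2 + u ^ 2) = 2 + 4 * u ^ 2 by ring]
  ring

/-- Tonelli: integrating the norm over `(d, q)` gives a constant times `‖subordinated z c y u‖`. -/
theorem integrable_tripleIntegrand {z : ℂ} (hz : 0 < z.re) {c : ℝ → ℝ} (hc : Measurable c)
    (hc0 : ∀ u, 0 ≤ c u) (y : ℝ) :
    Integrable (Function.uncurry (tripleIntegrand z c y))
      ((volume.restrict (Ioi 0)).prod (volume.prod (volume.restrict (Ioi 0)))) := by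
  rw [integrable_prod_iff (measurable_tripleIntegrand z hc y).aestronglyMeasurable]
  constructor
  · refine Filter.Eventually.of_forall fun u ↦ ?_
    simp only [Function.uncurry_apply_pair, tripleIntegrand]
    exact (Integrable.mul_prod (integrable_exp_neg_quadratic (b := 1 / 2 + u ^ 2)
      (by positivity) y).ofReal (integrableOn_cpow_mul_exp_neg_mul hz (m := 1 + 4 * u ^ 2)
      (by positivity))).const_mul _
  · simp only [Function.uncurry_apply_pair, integral_norm_tripleIntegrand hz]
    exact ((integrable_subordinated hz hc hc0 y).norm.const_mul _).integrableOn

theorem integral_subordinated {z : ℂ} (hz : 0 < z.re) {c : ℝ → ℝ} (hc : Measurable c)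
    (hc0 : ∀ u, 0 ≤ c u) (y : ℝ) :
    ∫ p in (univ : Set ℝ) ×ˢ Ioi (0 : ℝ), (p.2 : ℂ) ^ (z - 1) *
      (Real.exp (-p.2 - p.1 ^ 2 / 2 - y * p.1) : ℂ) *
        ((∫ u in Ioi (0 : ℝ), Real.exp (-((p.1 ^ 2 + 4 * p.2) * u ^ 2) - c u) : ℝ) : ℂ) =
      Complex.Gamma z * √Real.pi * ∫ u in Ioi (0 : ℝ), subordinated z c y u := by
  rw [← integral_const_mul]
  simp only [← integral_tripleIntegrand hz]
  rw [integral_integral_swap (integrable_tripleIntegrand hz hc hc0 y), Measure.volume_eq_prod,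
    ← Measure.prod_restrict, Measure.restrict_univ]
  refine integral_congr_ae (Filter.Eventually.of_forall fun p ↦ ?_)
  simp only [tripleIntegrand]
  rw [← integral_complex_ofReal, ← integral_const_mul]
  refine integral_congr_ae (Filter.Eventually.of_forall fun u ↦ ?_)
  have h : Real.exp (-p.2 - p.1 ^ 2 / 2 - y * p.1) *
      Real.exp (-((p.1 ^ 2 + 4 * p.2) * u ^ 2) - c u) = Real.exp (-c u) *
        (Real.exp (-((1 / 2 + u ^ 2) * p.1 ^ 2) - y * p.1) *
          Real.exp (-((1 + 4 * u ^ 2) * p.2))) := by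
    simp only [← Real.exp_add]
    ring_nf
  simp only
  rw [mul_assoc, ← Complex.ofReal_mul, h]
  push_cast
  ring

/-- In `h`, `y` carries the dependence on `t - r` and the `u`-integral that on `t + r`; the
denominator `t + r` cancels the Jacobian. The two products needed later differ only in `c` and `y`.
-/
theorem mul_integral_cpow_mul_exp_eq_subordinated {z : ℂ} (hz : 0 < z.re) {c : ℝ → ℝ}
    (hc : Measurable c) (hc0 : ∀ u, 0 ≤ c u) {y x₁ x₂ : ℝ}
    (h : ∀ t r : ℝ, 0 < t → 0 < r → Real.exp (-(y * (t - r))) *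
      ∫ u in Ioi (0 : ℝ), Real.exp (-((t + r) ^ 2 * u ^ 2) - c u) =
        √Real.pi / (2 * (t + r)) * Real.exp (-(x₁ * t) - x₂ * r)) :
    (∫ t in Ioi (0 : ℝ), (t : ℂ) ^ (z - 1) * (Real.exp (-(t ^ 2 / 2) - x₁ * t) : ℂ)) *
      (∫ t in Ioi (0 : ℝ), (t : ℂ) ^ (z - 1) * (Real.exp (-(t ^ 2 / 2) - x₂ * t) : ℂ)) =
      2 * Complex.Gamma z * ∫ u in Ioi (0 : ℝ), subordinated z c y u := by
  have hpi : (√Real.pi : ℂ) ≠ 0 := by exact_mod_cast (Real.sqrt_pos.2 Real.pi_pos).ne'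
  have hs := integral_subordinated hz hc hc0 y
  rw [← setIntegral_quadrant_sub_mul] at hs
  have hm : MeasurableSet (Ioi (0 : ℝ) ×ˢ Ioi (0 : ℝ)) := measurableSet_Ioi.prod measurableSet_Ioi
  rw [← setIntegral_prod_mul, ← Measure.volume_eq_prod,
    show 2 * Complex.Gamma z * ∫ u in Ioi (0 : ℝ), subordinated z c y u =
      2 / √Real.pi * (Complex.Gamma z * √Real.pi * ∫ u in Ioi (0 : ℝ), subordinated z c y u) by
        field_simp, ← hs, ← integral_const_mul]
  refine setIntegral_congr_fun hm fun p hp ↦ ?_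
  obtain ⟨t, r⟩ := p
  have ht : 0 < t := hp.1
  have hr : 0 < r := hp.2
  have hJ := h t r ht hr
  simp only
  rw [show (t - r) ^ 2 + 4 * (t * r) = (t + r) ^ 2 by ring]
  generalize ∫ u in Ioi (0 : ℝ), Real.exp (-((t + r) ^ 2 * u ^ 2) - c u) = J at hJ ⊢
  have e : Real.exp (-(t * r) - (t - r) ^ 2 / 2 - y * (t - r)) * J * (t + r) =
      √Real.pi / 2 * (Real.exp (-(t ^ 2 / 2) - x₁ * t) * Real.exp (-(r ^ 2 / 2) - x₂ * r)) := by
    rw [show -(t * r) - (t - r) ^ 2 / 2 - y * (t - r) =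
      (-(t ^ 2 / 2) - r ^ 2 / 2) + -(y * (t - r)) by ring, Real.exp_add, mul_assoc _ _ J, hJ,
      ← Real.exp_add, show -(t ^ 2 / 2) - x₁ * t + (-(r ^ 2 / 2) - x₂ * r) =
        (-(t ^ 2 / 2) - r ^ 2 / 2) + (-(x₁ * t) - x₂ * r) by ring, Real.exp_add _ (_ - _)]
    have : t + r ≠ 0 := by positivity
    field_simp
  have e' := congrArg (fun a : ℝ ↦ (a : ℂ)) e
  simp only [Complex.ofReal_mul, Complex.ofReal_div] at e' ⊢
  rw [Complex.mul_cpow_ofReal_nonneg ht.le hr.le]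
  have e'' : 2 / (√Real.pi : ℂ) * ((Real.exp (-(t * r) - (t - r) ^ 2 / 2 - y * (t - r)) : ℂ) * J *
      ((t + r : ℝ) : ℂ)) = (Real.exp (-(t ^ 2 / 2) - x₁ * t) : ℂ) *
        (Real.exp (-(r ^ 2 / 2) - x₂ * r) : ℂ) := by
    rw [e']
    push_cast
    field_simp
  linear_combination (-(t : ℂ) ^ (z - 1) * (r : ℂ) ^ (z - 1)) * e''

theorem parabolicD_mul_parabolicD_eq_subordinated {z : ℂ} (hz : 0 < z.re) {c : ℝ → ℝ}
    (hc : Measurable c) (hc0 : ∀ u, 0 ≤ c u) {y x₁ x₂ : ℝ}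
    (h : ∀ t r : ℝ, 0 < t → 0 < r → Real.exp (-(y * (t - r))) *
      ∫ u in Ioi (0 : ℝ), Real.exp (-((t + r) ^ 2 * u ^ 2) - c u) =
        √Real.pi / (2 * (t + r)) * Real.exp (-(x₁ * t) - x₂ * r)) :
    parabolicD (-z) x₁ * parabolicD (-z) x₂ = (Complex.Gamma z)⁻¹ *
      ∫ u in Ioi (0 : ℝ), 2 * (Real.exp (-((x₁ ^ 2 + x₂ ^ 2) / 4)) : ℂ) *
        subordinated z c y u := by
  have hp := mul_integral_cpow_mul_exp_eq_subordinated hz hc hc0 h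
  have hg := Complex.Gamma_ne_zero_of_re_pos hz
  rw [parabolicD_neg_eq_integral hz, parabolicD_neg_eq_integral hz, mul_mul_mul_comm, hp,
    integral_const_mul, show -((x₁ ^ 2 + x₂ ^ 2) / 4) = -(x₁ ^ 2 / 4) + -(x₂ ^ 2 / 4) by ring,
    Real.exp_add]
  push_cast
  field_simp

/-- Here the linear exponent is `-x(t + r)`, produced entirely by the `u`-integral with `b = x/2`;
this is where `x ≥ 0` enters. -/
theorem parabolicD_mul_self_eq_subordinated {z : ℂ} (hz : 0 < z.re) {x : ℝ} (hx : 0 ≤ x) :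
    parabolicD (-z) x * parabolicD (-z) x = (Complex.Gamma z)⁻¹ *
      ∫ u in Ioi (0 : ℝ), 2 * (Real.exp (-(x ^ 2 / 2)) : ℂ) *
        subordinated z (fun u ↦ (x / 2) ^ 2 / u ^ 2) 0 u := by
  rw [parabolicD_mul_parabolicD_eq_subordinated hz (c := fun u ↦ (x / 2) ^ 2 / u ^ 2) (y := 0)
    (by fun_prop) (fun u ↦ by positivity)]
  · rw [show (x ^ 2 + x ^ 2) / 4 = x ^ 2 / 2 by ring]
  · intro t r ht hr
    rw [integral_exp_neg_sq_sub_inv_sq (add_pos ht hr) (by positivity)]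
    ring_nf
    simp

/-- Now the linear exponent is `-x(t - r)`, so `y = x` and the `u`-integral, with `b = 0`, supplies
only `1/(t + r)`. -/
theorem parabolicD_mul_neg_eq_subordinated {z : ℂ} (hz : 0 < z.re) (x : ℝ) :
    parabolicD (-z) x * parabolicD (-z) (-x) = (Complex.Gamma z)⁻¹ *
      ∫ u in Ioi (0 : ℝ), 2 * (Real.exp (-(x ^ 2 / 2)) : ℂ) *
        subordinated z (fun _ ↦ 0) x u := by
  rw [← Complex.ofReal_neg, parabolicD_mul_parabolicD_eq_subordinated hz (c := fun _ ↦ 0) (y := x)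
    (by fun_prop) (fun u ↦ le_rfl)]
  · rw [show (x ^ 2 + (-x) ^ 2) / 4 = x ^ 2 / 2 by ring]
  · intro t r ht hr
    have h := integral_exp_neg_sq_sub_inv_sq (add_pos ht hr) (le_refl 0)
    simp only [ne_eq, OfNat.ofNat_ne_zero, not_false_eq_true, zero_pow, zero_div, mul_zero,
      neg_zero, Real.exp_zero, mul_one] at h
    rw [h]
    ring_nf

/-! ### The substitutions from `u` to `s`. -/

/-- The `z`-dependence is only through `(s+1)/|s-1|`. Setting this ratio equal to `1 + 4u²` and
solving on each side of `s = 1` gives the two substitutions used below. -/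
theorem plusIntegrand_eq_of_add_one_eq {z : ℂ} {x s u : ℝ} (hs1 : s ≠ 1)
    (hu : s + 1 = (1 + 4 * u ^ 2) * |s - 1|) :
    plusIntegrand z x s = ((1 + 4 * u ^ 2 : ℝ) : ℂ) ^ (-z) *
      ((|s - 1|⁻¹ * Real.exp (-(x ^ 2 / 2) * s) / √s : ℝ) : ℂ) := by
  have ha : 0 < |s - 1| := abs_pos.2 (sub_ne_zero.2 hs1)
  have ha' : ((|s - 1| : ℝ) : ℂ) ≠ 0 := by exact_mod_cast ha.ne'
  have hne : ((|s - 1| : ℝ) : ℂ) ^ z ≠ 0 := by simp [Complex.cpow_eq_zero_iff, ha']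
  rw [plusIntegrand, hu, Complex.ofReal_mul, Complex.mul_cpow_ofReal_nonneg (by positivity) ha.le,
    Complex.cpow_sub _ _ ha', Complex.cpow_one, Complex.cpow_neg]
  generalize ((|s - 1| : ℝ) : ℂ) ^ z = w at *
  generalize ((1 + 4 * u ^ 2 : ℝ) : ℂ) ^ z = v at *
  push_cast
  field_simp

theorem minusIntegrand_of_one_lt {z : ℂ} {x s : ℝ} (hs : 1 < s) :
    minusIntegrand z x s = plusIntegrand z x s := by
  have ha : ((s - 1 : ℝ) : ℂ) ≠ 0 := by exact_mod_cast (sub_pos.2 hs).ne'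
  rw [minusIntegrand, plusIntegrand, abs_of_pos (sub_pos.2 hs), Complex.cpow_sub _ _ ha,
    Complex.cpow_one]
  ring

theorem minusIntegrand_of_lt_one {z : ℂ} {x s : ℝ} (hs : s < 1) :
    minusIntegrand z x s = -plusIntegrand z x s := by
  have ha : ((s - 1 : ℝ) : ℂ) ≠ 0 := by exact_mod_cast (sub_neg.2 hs).ne
  rw [minusIntegrand, plusIntegrand, abs_of_neg (sub_neg.2 hs), Complex.ofReal_neg,
    Complex.cpow_sub _ _ (neg_ne_zero.2 ha), Complex.cpow_one, div_neg, one_div]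
  ring

theorem image_one_add_inv_sq_Ioi : (fun u : ℝ ↦ 1 + 1 / (2 * u ^ 2)) '' Ioi 0 = Ioi 1 := by
  ext s
  simp only [mem_image, mem_Ioi]
  constructor
  · rintro ⟨u, hu, rfl⟩
    have : 0 < 1 / (2 * u ^ 2) := by positivity
    linarith
  · intro hs
    have hs' : 0 < s - 1 := by linarith
    refine ⟨√(1 / (2 * (s - 1))), Real.sqrt_pos.2 (by positivity), ?_⟩
    rw [Real.sq_sqrt (by positivity)]
    field_simp
    ring

theorem image_sq_div_one_add_sq_Ioi :
    (fun u : ℝ ↦ 2 * u ^ 2 / (1 + 2 * u ^ 2)) '' Ioi 0 = Ioo 0 1 := by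
  ext s
  simp only [mem_image, mem_Ioi, mem_Ioo]
  constructor
  · rintro ⟨u, hu, rfl⟩
    refine ⟨by positivity, ?_⟩
    rw [div_lt_one (by positivity)]
    linarith
  · rintro ⟨hs0, hs⟩
    have hs' : 0 < 1 - s := by linarith
    refine ⟨√(s / (2 * (1 - s))), Real.sqrt_pos.2 (by positivity), ?_⟩
    rw [Real.sq_sqrt (by positivity)]
    field_simp
    ring

theorem injOn_one_add_inv_sq_Ioi : InjOn (fun u : ℝ ↦ 1 + 1 / (2 * u ^ 2)) (Ioi 0) := by
  intro u hu v hv h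
  have hu : 0 < u := hu
  have hv : 0 < v := hv
  simp only [add_right_inj] at h
  field_simp at h
  exact ((sq_eq_sq₀ hv.le hu.le).1 h).symm

theorem injOn_sq_div_one_add_sq_Ioi :
    InjOn (fun u : ℝ ↦ 2 * u ^ 2 / (1 + 2 * u ^ 2)) (Ioi 0) := by
  intro u hu v hv h
  have hu : 0 < u := hu
  have hv : 0 < v := hv
  simp only at h
  rw [div_eq_div_iff (by positivity) (by positivity)] at h
  exact (sq_eq_sq₀ hu.le hv.le).1 (by linear_combination h / 2)

theorem hasDerivAt_one_add_inv_sq {u : ℝ} (hu : 0 < u) :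
    HasDerivAt (fun u : ℝ ↦ 1 + 1 / (2 * u ^ 2)) (-(u ^ 3)⁻¹) u := by
  have h := ((((hasDerivAt_pow 2 u).const_mul 2).inv (by positivity)).const_add 1)
  convert! h using 1
  · ext; simp
  · field_simp
    norm_num
    ring

theorem hasDerivAt_sq_div_one_add_sq (u : ℝ) :
    HasDerivAt (fun u : ℝ ↦ 2 * u ^ 2 / (1 + 2 * u ^ 2)) (4 * u / (1 + 2 * u ^ 2) ^ 2) u := by
  have h1 := (hasDerivAt_pow 2 u).const_mul 2
  have h := h1.div (h1.const_add 1) (by positivity)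
  convert! h using 1
  field_simp
  norm_num

theorem abs_deriv_smul_plusIntegrand_one_add_inv_sq {z : ℂ} {x u : ℝ} (hu : 0 < u) :
    |-(u ^ 3)⁻¹| • plusIntegrand z x (1 + 1 / (2 * u ^ 2)) =
      2 * (Real.exp (-(x ^ 2 / 2)) : ℂ) * subordinated z (fun u ↦ (x / 2) ^ 2 / u ^ 2) 0 u := by
  have hpos : 0 < 1 / (2 * u ^ 2) := by positivity
  have habs : |1 + 1 / (2 * u ^ 2) - 1| = 1 / (2 * u ^ 2) := by
    rw [add_sub_cancel_left, abs_of_pos hpos]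
  have hsq : √(1 + 1 / (2 * u ^ 2)) = √(1 / 2 + u ^ 2) / u := by
    rw [show 1 + 1 / (2 * u ^ 2) = (1 / 2 + u ^ 2) / u ^ 2 by field_simp; ring,
      Real.sqrt_div (by positivity), Real.sqrt_sq hu.le]
  have hexp : Real.exp (-(x ^ 2 / 2) * (1 + 1 / (2 * u ^ 2))) = Real.exp (-(x ^ 2 / 2)) *
      Real.exp (-((x / 2) ^ 2 / u ^ 2) + 0 ^ 2 / (2 + 4 * u ^ 2)) := by
    rw [← Real.exp_add]
    congr 1
    field_simp
    ring
  rw [plusIntegrand_eq_of_add_one_eq (u := u) (by linarith)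
    (by rw [habs]; field_simp; ring), subordinated, habs, hsq, hexp, abs_neg,
    abs_of_pos (by positivity), Complex.real_smul]
  have hR : (√(1 / 2 + u ^ 2) : ℂ) ≠ 0 := by
    exact_mod_cast (Real.sqrt_pos.2 (by positivity)).ne'
  have hu' : (u : ℂ) ≠ 0 := by exact_mod_cast hu.ne'
  generalize √(1 / 2 + u ^ 2) = R at *
  push_cast
  field_simp

theorem abs_deriv_smul_plusIntegrand_sq_div_one_add_sq {z : ℂ} {x u : ℝ} (hu : 0 < u) :
    |4 * u / (1 + 2 * u ^ 2) ^ 2| • plusIntegrand z x (2 * u ^ 2 / (1 + 2 * u ^ 2)) =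
      2 * (Real.exp (-(x ^ 2 / 2)) : ℂ) * subordinated z (fun _ ↦ 0) x u := by
  have hpos : 0 < 2 * u ^ 2 / (1 + 2 * u ^ 2) := by positivity
  have hsub : 2 * u ^ 2 / (1 + 2 * u ^ 2) - 1 = -(1 / (1 + 2 * u ^ 2)) := by
    field_simp
    ring
  have hpos' : 0 < 1 / (1 + 2 * u ^ 2) := by positivity
  have habs : |2 * u ^ 2 / (1 + 2 * u ^ 2) - 1| = 1 / (1 + 2 * u ^ 2) := by
    rw [hsub, abs_neg, abs_of_pos hpos']
  have hsq : √(2 * u ^ 2 / (1 + 2 * u ^ 2)) = u / √(1 / 2 + u ^ 2) := by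
    rw [show 2 * u ^ 2 / (1 + 2 * u ^ 2) = u ^ 2 / (1 / 2 + u ^ 2) by field_simp,
      Real.sqrt_div (by positivity), Real.sqrt_sq hu.le]
  have hexp : Real.exp (-(x ^ 2 / 2) * (2 * u ^ 2 / (1 + 2 * u ^ 2))) = Real.exp (-(x ^ 2 / 2)) *
      Real.exp (-0 + x ^ 2 / (2 + 4 * u ^ 2)) := by
    rw [← Real.exp_add]
    congr 1
    field_simp
    ring
  rw [plusIntegrand_eq_of_add_one_eq (u := u) (by linarith)
    (by rw [habs]; field_simp; ring), subordinated, habs, hsq, hexp,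
    abs_of_pos (by positivity), Complex.real_smul, mul_left_comm, mul_left_comm (2 * _)]
  congr 1
  have hR : 0 < √(1 / 2 + u ^ 2) := Real.sqrt_pos.2 (by positivity)
  -- Expressing everything through `√(1/2 + u²)` makes the Jacobian identity rational.
  have hR2 : 1 + 2 * u ^ 2 = 2 * √(1 / 2 + u ^ 2) ^ 2 := by
    rw [Real.sq_sqrt (by positivity)]; ring
  rw [hR2]
  generalize √(1 / 2 + u ^ 2) = R at *
  norm_cast
  field_simp
  norm_num

theorem integrableOn_plusIntegrand_Ioi_one {z : ℂ} (hz : 0 < z.re) (x : ℝ) :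
    IntegrableOn (plusIntegrand z x) (Ioi 1) := by
  rw [← image_one_add_inv_sq_Ioi, integrableOn_image_iff_integrableOn_abs_deriv_smul
    measurableSet_Ioi (fun u hu ↦ (hasDerivAt_one_add_inv_sq hu).hasDerivWithinAt)
    injOn_one_add_inv_sq_Ioi]
  refine IntegrableOn.congr_fun ?_
    (fun u hu ↦ (abs_deriv_smul_plusIntegrand_one_add_inv_sq hu).symm) measurableSet_Ioi
  exact ((integrable_subordinated hz (by fun_prop) (fun u ↦ by positivity) 0).const_mul
    _).integrableOn

theorem integrableOn_plusIntegrand_Ioo {z : ℂ} (hz : 0 < z.re) (x : ℝ) :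
    IntegrableOn (plusIntegrand z x) (Ioo 0 1) := by
  rw [← image_sq_div_one_add_sq_Ioi, integrableOn_image_iff_integrableOn_abs_deriv_smul
    measurableSet_Ioi (fun u hu ↦ (hasDerivAt_sq_div_one_add_sq u).hasDerivWithinAt)
    injOn_sq_div_one_add_sq_Ioi]
  refine IntegrableOn.congr_fun ?_
    (fun u hu ↦ (abs_deriv_smul_plusIntegrand_sq_div_one_add_sq hu).symm) measurableSet_Ioi
  exact ((integrable_subordinated hz (by fun_prop) (fun u ↦ le_rfl) x).const_mul _).integrableOn

/-! ### The two products as integrals over `s`, and their combination. -/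

theorem parabolicD_mul_self {z : ℂ} (hz : 0 < z.re) {x : ℝ} (hx : 0 ≤ x) :
    parabolicD (-z) x * parabolicD (-z) x =
      (Complex.Gamma z)⁻¹ * ∫ s in Ioi (1 : ℝ), plusIntegrand z x s := by
  rw [parabolicD_mul_self_eq_subordinated hz hx, ← image_one_add_inv_sq_Ioi,
    integral_image_eq_integral_abs_deriv_smul
    measurableSet_Ioi (fun u hu ↦ (hasDerivAt_one_add_inv_sq hu).hasDerivWithinAt)
    injOn_one_add_inv_sq_Ioi, setIntegral_congr_fun measurableSet_Ioi
    (fun u hu ↦ abs_deriv_smul_plusIntegrand_one_add_inv_sq hu)]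

theorem parabolicD_mul_neg {z : ℂ} (hz : 0 < z.re) (x : ℝ) :
    parabolicD (-z) x * parabolicD (-z) (-x) =
      (Complex.Gamma z)⁻¹ * ∫ s in Ioo (0 : ℝ) 1, plusIntegrand z x s := by
  rw [parabolicD_mul_neg_eq_subordinated hz x, ← image_sq_div_one_add_sq_Ioi,
    integral_image_eq_integral_abs_deriv_smul
    measurableSet_Ioi (fun u hu ↦ (hasDerivAt_sq_div_one_add_sq u).hasDerivWithinAt)
    injOn_sq_div_one_add_sq_Ioi, setIntegral_congr_fun measurableSet_Ioi
    (fun u hu ↦ abs_deriv_smul_plusIntegrand_sq_div_one_add_sq hu)]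

/-- Splitting an integral over the half-line at `1`. -/
theorem integrableOn_and_integral_Ioi_split {f : ℝ → ℂ} (h0 : IntegrableOn f (Ioo 0 1))
    (h1 : IntegrableOn f (Ioi 1)) : IntegrableOn f (Ioi 0) ∧
      ∫ s in Ioi (0 : ℝ), f s = (∫ s in Ioo (0 : ℝ) 1, f s) + ∫ s in Ioi (1 : ℝ), f s := by
  have h0' : IntegrableOn f (Ioc 0 1) := (integrableOn_Ioc_iff_integrableOn_Ioo (by simp)).2 h0
  rw [← Ioc_union_Ioi_eq_Ioi (zero_le_one : (0 : ℝ) ≤ 1), ← integral_Ioc_eq_integral_Ioo]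
  exact ⟨h0'.union h1, setIntegral_union (Ioc_disjoint_Ioi le_rfl) measurableSet_Ioi h0' h1⟩

theorem mainTheorem5 (z : ℂ) (hz : 0 < z.re) (x : ℝ) (hx : 0 ≤ x) :
    (IntegrableOn (plusIntegrand z x) (Ioi 0) ∧
      parabolicD (-z) x * (parabolicD (-z) x + parabolicD (-z) (-x)) =
        (Complex.Gamma z)⁻¹ * ∫ s in Ioi (0 : ℝ), plusIntegrand z x s) ∧
    (IntegrableOn (minusIntegrand z x) (Ioi 0) ∧
      parabolicD (-z) x * (parabolicD (-z) x - parabolicD (-z) (-x)) =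
        (Complex.Gamma z)⁻¹ * ∫ s in Ioi (0 : ℝ), minusIntegrand z x s) := by
  have i0 := integrableOn_plusIntegrand_Ioo hz x
  have i1 := integrableOn_plusIntegrand_Ioi_one hz x
  obtain ⟨hi, hs⟩ := integrableOn_and_integral_Ioi_split i0 i1
  -- The factor `1/(s - 1)` only changes the sign on `(0, 1)`, turning the sum of the two products
  -- into their difference.
  have e0 : EqOn (minusIntegrand z x) (fun s ↦ -plusIntegrand z x s) (Ioo 0 1) :=
    fun s hs ↦ minusIntegrand_of_lt_one hs.2
  have e1 : EqOn (minusIntegrand z x) (plusIntegrand z x) (Ioi 1) :=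
    fun s hs ↦ minusIntegrand_of_one_lt hs
  obtain ⟨hi', hs'⟩ := integrableOn_and_integral_Ioi_split
    ((integrableOn_congr_fun e0 measurableSet_Ioo).2 i0.neg)
    ((integrableOn_congr_fun e1 measurableSet_Ioi).2 i1)
  rw [setIntegral_congr_fun measurableSet_Ioo e0, setIntegral_congr_fun measurableSet_Ioi e1,
    integral_neg] at hs'
  have hA := parabolicD_mul_self hz hx
  have hB := parabolicD_mul_neg hz x
  refine ⟨⟨hi, ?_⟩, hi', ?_⟩
  · rw [hs]
    linear_combination hA + hB
  · rw [hs']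
    linear_combination hA - hB
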